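/- **Setting.** A probabilistically labeled deterministic MDP consists of finite sets $X$ (states), $\Sigma\neq\emptyset$ (actions), $O$ (observations), a transition function $\delta:X\times\Sigma\to X$, a set $L(x)\subseteq 2^O$ of possible labels and a true label $l_{true}(x)\in L(x)$ for every $x\in X$, a belief $p_L$ (for each $x$, $p_L(x,\cdot)$ is a probability distribution on $2^O$ vanishing outside $L(x)$), and a uniform transition cost $\beta>0$. $N_x^h$ is the set of states reachable from $x$ by at most $h$ transitions ($x$ included). Let $\gamma\in(0,1)$, $h\ge 1$, $x_0\in X$. Let $\phi$ be an scLTL formula without next ($\phi=\top\mid o\mid\neg o\mid\phi_1\lor\phi_2\mid\phi_1\land\phi_2\mid\phi_1\,\mathcal U\,\phi_2\mid\lozenge\phi_1$, $o\in O$), let $\mathscr L_{pref,\phi}$ be the set of finite words over $2^O$ all of whose infinite extensions satisfy $\phi$, and let $\mathcal A=(S,s_0,2^O,\delta_a,F_a,s_t)$ be a finite total DFA accepting exactly $\mathscr L_{pref,\phi}$, where $s_t\notin F_a$, $s_t\ne s_0$, is an absorbing trash state. The product automaton $\mathcal P$ has states $X\times S$, transition probabilities $p_p((x,s),\sigma,(x',s'))=\sum_{l:\,\delta_a(s,l)=s'}p_L(x',l)$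 if $\delta(x,\sigma)=x'$ and $0$ otherwise, accepting states $\mathcal F_a=X\times F_a$ and trash states $\mathcal F_t=X\times\{s_t\}$. The reward $r(s_p,\sigma,s_p')$ of a transition with $s_p=(x,s)$, $s_p'=(x',s')$ is $-\beta/(1-\gamma)$ if $s_p\notin\mathcal F_t$, $s_p'\in\mathcal F_t$ and $\delta(x,\sigma)=x'$; otherwise it is $0$ if $s_p\in\mathcal F_a\cup\mathcal F_t$, and $-\beta$ in all remaining cases. The expected return of a policy $\pi:X\times S\to\Sigma$ from $s_p$ is $U^{\pi}(s_p)=\mathbb E^{\pi}\big[\sum_{i\ge 0}\gamma^i r(s_p(i),\pi(s_p(i)),s_p(i+1))\mid s_p(0)=s_p\big]$, and $\pi$ is optimal if it maximizes $U^\pi(s_p)$ for all $s_p$ simultaneously. **Algorithm.** Start in $x_0$ with the automaton in a state $q_0\neq s_t$, where $q_0=s_0$ (the label of $x_0$ is not read) or $q_0=\delta_a(s_0,l_{true}(x_0))$ (it is read), and with $t=0$. While the current product state $(x,s)$ is not in $\mathcal F_a$: sense the true labels of all states in $N_x^h$ (Assumption 1) and set $p_L(y,\cdot)$ to the point mass at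 $l_{true}(y)$ for each $y\in N_x^h$; if $t=0$ or the belief held before this sensing was not exactly correct on $N_x^h$ (the information matrix, with entries $|\mathbf 1[l=l_{true}(y)]-p_L(y,l)|$ for $y\in N_x^h$, $l\in 2^O$, has non-zero infinity norm), call the planner on the product automaton with the updated belief to get a new policy, and otherwise keep the old one; execute the action $\sigma$ that the policy assigns to $(x,s)$, append it to the output, move to $x'=\delta(x,\sigma)$ and $s'=\delta_a(s,l_{true}(x'))$, and increase $t$ by one. The planner is one of the following. * (a) It returns any optimal policy. * (b) It is value iteration with convergence threshold $\varepsilon_0>0$: starting from $v=0$, it makes passes over the product states in any order, replacing $v(s_p)$ in place by $\max_\sigma\sum_{s_p'}p_p(s_p,\sigma,s_p')(r(s_p,\sigma,s_p')+\gamma v(s_p'))$, until the largest change in a pass is at most $\varepsilon_0$, and returns any policy that is greedy for the final $v$. **Assumption 2.** At any time during the mission there is, for the product automaton with the current (just updated) belief, a policy $\pi$ such that from every state outside $\mathcal F_t$ some trajectory made of transitions of non-zero probability under $\pi$ visits $\mathcal F_a$. **Theorem.** Under Assumptions 1 and 2 the algorithm with planner (a), for any choice among the optimal policies, terminates. Value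 iteration terminates for every $\varepsilon_0>0$, every belief and every processing order, and there is $\varepsilon_{\max}>0$ such that for all $0<\varepsilon_0\le\varepsilon_{\max}$, under the same assumptions, the algorithm with planner (b), for any processing orders and tie-breaking, terminates. In either case, let $\sigma(0)\cdots\sigma(n)$ be the returned action sequence (possibly empty) and $x(0)=x_0,\,x(1),\dots,x(n+1)$ the trajectory that it generates. If $q_0=s_0$, then $l_{true}(x(1))\cdots l_{true}(x(n+1))\in\mathscr L_{pref,\phi}$. If $q_0=\delta_a(s_0,l_{true}(x_0))$ (in particular, if $q_0=s_0$ and reading $l_{true}(x_0)$ leaves $s_0$ unchanged), then $l_{true}(x(0))\,l_{true}(x(1))\cdots l_{true}(x(n+1))\in\mathscr L_{pref,\phi}$. -/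

import Mathlib

open scoped Classical
open MeasureTheory ProbabilityTheory

/-! ### Syntactically co-safe LTL without the next operator -/

/-- scLTL formulae over a set `O` of observations. -/
inductive SCLTL (O : Type*) where
  | top : SCLTL O
  | obs : O → SCLTL O
  | negObs : O → SCLTL O
  | or : SCLTL O → SCLTL O → SCLTL O
  | and : SCLTL O → SCLTL O → SCLTL O
  | until : SCLTL O → SCLTL O → SCLTL O
  | eventually : SCLTL O → SCLTL O

namespace SCLTL

variable {O : Type*}

/-- `Sat φ w i`: the suffix of the infinite word `w` that starts at position `i` satisfies `φ`. -/
def Sat : SCLTL O → (ℕ → Finset O) → ℕ → Prop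
  | top, _, _ => True
  | obs o, w, i => o ∈ w i
  | negObs o, w, i => o ∉ w i
  | or φ ψ, w, i => φ.Sat w i ∨ ψ.Sat w i
  | and φ ψ, w, i => φ.Sat w i ∧ ψ.Sat w i
  | .until φ ψ, w, i => ∃ j, i ≤ j ∧ ψ.Sat w j ∧ ∀ k, i ≤ k → k < j → φ.Sat w k
  | eventually φ, w, i => ∃ j, i ≤ j ∧ φ.Sat w j

/-- The infinite word `u` preceded by the finite word `w`. -/
def prepend (w : List (Finset O)) (u : ℕ → Finset O) : ℕ → Finset O :=
  fun n => if hn : n < w.length then w[n] else u (n - w.length)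

/-- The finite words all of whose infinite extensions satisfy `φ`. -/
def goodPrefixes (φ : SCLTL O) : Language (Finset O) :=
  {w | ∀ u : ℕ → Finset O, φ.Sat (prepend w u) 0}

end SCLTL

/-! ### Total DFA and probabilistically labeled deterministic MDP -/

/-- A total DFA over the alphabet `2^O` with its trash state: an absorbing non-accepting state
other than the initial one. -/
structure TotalDFA (O S : Type*) extends DFA (Finset O) S where
  trash : S
  step_trash : ∀ l, step trash l = trash
  trash_not_accept : trash ∉ accept
  start_ne_trash : start ≠ trash

/-- Probabilistically labeled deterministic MDP. -/
structure PLDMDP (X Act O : Type*) where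
  /-- transition function -/
  δ : X → Act → X
  /-- the labels that are possible in a state -/
  L : X → Finset (Finset O)
  /-- the true labels -/
  ltrue : X → Finset O
  ltrue_mem : ∀ x, ltrue x ∈ L x
  /-- the current belief about the labels -/
  pL : X → Finset O → ℝ
  pL_nonneg : ∀ x l, 0 ≤ pL x l
  pL_le_one : ∀ x l, pL x l ≤ 1
  pL_sum : ∀ x, ∑ l ∈ L x, pL x l = 1
  pL_support : ∀ x l, l ∉ L x → pL x l = 0
  /-- cost -/
  c : X → X → ℝ
  c_pos : ∀ x y, 0 < c x y

namespace PLDMDP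

variable {X Act O S : Type*}

/-- `N_x^h`: the states that can be reached from `x` by at most `h` transitions. -/
def hopNbhd (M : PLDMDP X Act O) (h : ℕ) (x : X) : Set X :=
  {y | ∃ σs : List Act, σs.length ≤ h ∧ σs.foldl M.δ x = y}

/-- The states visited from `x` under a finite action sequence, `x` included. -/
def trajectory (M : PLDMDP X Act O) (x : X) (σs : List Act) : List X :=
  List.scanl M.δ x σs

/-- The word generated from `x` by a finite action sequence: the true labels of all states of its
trajectory, that of `x` included. -/
def word (M : PLDMDP X Act O) (x : X) (σs : List Act) : List (Finset O) :=
  (M.trajectory x σs).map M.ltrue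

/-- The model after the true labels of the states in `N` have been entered into the belief. -/
noncomputable def updateMap (M : PLDMDP X Act O) (N : Set X) : PLDMDP X Act O where
  δ := M.δ
  L := M.L
  ltrue := M.ltrue
  ltrue_mem := M.ltrue_mem
  pL x l := if x ∈ N then (if l = M.ltrue x then 1 else 0) else M.pL x l
  pL_nonneg x l := by
    have := M.pL_nonneg x l
    split_ifs <;> simp [this]
  pL_le_one x l := by
    have := M.pL_le_one x l
    split_ifs <;> simp [this]
  pL_sum x := by
    by_cases hx : x ∈ N
    · simp [hx, M.ltrue_mem x]
    · simpa [hx] using M.pL_sum x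
  pL_support x l hl := by
    have h1 : l ≠ M.ltrue x := fun h => hl (h ▸ M.ltrue_mem x)
    simp [h1, M.pL_support x l hl]
  c := M.c
  c_pos := M.c_pos

/-- Information matrix of a set `N` of states: the entrywise distance between the true label
distribution and the belief. -/
noncomputable def infoMatrix (M : PLDMDP X Act O) (N : Set X) : Matrix N (Finset O) ℝ :=
  fun x l => if M.ltrue x = l then |1 - M.pL x l| else |0 - M.pL x l|

/-- The infinity norm (largest absolute row sum) of the information matrix. -/
noncomputable def infoNorm [Fintype O] (M : PLDMDP X Act O) (N : Set X) : ℝ :=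
  ⨆ x : N, ∑ l : Finset O, |M.infoMatrix N x l|

/-! ### Product automaton -/

/-- Transition relation of the product automaton, on the states `X × S`. -/
def prodEdge (M : PLDMDP X Act O) (A : TotalDFA O S) (s s' : X × S) : Prop :=
  (∃ σ, M.δ s.1 σ = s'.1) ∧ ∃ l ∈ M.L s'.1, 0 ≤ M.pL s'.1 l ∧ A.step s.2 l = s'.2

/-- Transition probabilities of the product automaton. -/
noncomputable def prodProb [Fintype O] (M : PLDMDP X Act O) (A : TotalDFA O S)
    (s : X × S) (σ : Act) (s' : X × S) : ℝ :=
  if M.prodEdge A s s' ∧ M.δ s.1 σ = s'.1 then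
    ∑ l : Finset O with A.step s.2 l = s'.2, M.pL s'.1 l
  else 0

theorem prodProb_eq [Fintype O] (M : PLDMDP X Act O) (A : TotalDFA O S)
    (s : X × S) (σ : Act) (s' : X × S) :
    M.prodProb A s σ s' = if M.δ s.1 σ = s'.1 then
      ∑ l : Finset O with A.step s.2 l = s'.2, M.pL s'.1 l else 0 := by
  unfold prodProb
  by_cases h1 : M.δ s.1 σ = s'.1
  · by_cases h2 : M.prodEdge A s s'
    · simp [h1, h2]
    · simp only [h1, h2, false_and, if_false, if_true]
      symm
      refine Finset.sum_eq_zero fun l hl => ?_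
      by_contra h3
      refine h2 ⟨⟨σ, h1⟩, l, ?_, M.pL_nonneg _ _, (Finset.mem_filter.1 hl).2⟩
      by_contra h4
      exact h3 (M.pL_support _ _ h4)
  · simp [h1]

theorem prodProb_nonneg [Fintype O] (M : PLDMDP X Act O) (A : TotalDFA O S)
    (s : X × S) (σ : Act) (s' : X × S) : 0 ≤ M.prodProb A s σ s' := by
  unfold prodProb
  split_ifs
  · exact Finset.sum_nonneg fun l _ => M.pL_nonneg _ _
  · exact le_rfl

theorem prodProb_sum [Fintype O] [Fintype X] [Fintype S] (M : PLDMDP X Act O) (A : TotalDFA O S)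
    (s : X × S) (σ : Act) : ∑ s' : X × S, M.prodProb A s σ s' = 1 := by
  simp only [prodProb_eq, Fintype.sum_prod_type]
  rw [Finset.sum_eq_single (M.δ s.1 σ)]
  · simp only [if_true]
    have h1 : ∑ l ∈ M.L (M.δ s.1 σ), M.pL (M.δ s.1 σ) l = ∑ l, M.pL (M.δ s.1 σ) l :=
      Finset.sum_subset (Finset.subset_univ _) fun l _ hl => M.pL_support _ _ hl
    rw [← M.pL_sum (M.δ s.1 σ), h1]
    simp only [Finset.sum_filter]
    rw [Finset.sum_comm]
    simp
  · intro x _ hx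
    simp [hx.symm]
  · simp

end PLDMDP

namespace TotalDFA

variable {X O S : Type*}

/-- Accepting states of the product automaton. -/
def prodAccept (A : TotalDFA O S) : Set (X × S) := {s | s.2 ∈ A.accept}

/-- Trash states of the product automaton. -/
def prodTrash (A : TotalDFA O S) : Set (X × S) := {s | s.2 = A.trash}

end TotalDFA

namespace PLDMDP

variable {X Act O S : Type*} [Fintype X] [Fintype Act] [Fintype O] [Fintype S]

/-! ### Reward, expected return, optimal policies -/

/-- The reward function of the product automaton. -/
noncomputable def reward (M : PLDMDP X Act O) (A : TotalDFA O S) (β γ : ℝ)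
    (s : X × S) (σ : Act) (s' : X × S) : ℝ :=
  if s ∉ A.prodTrash ∧ s' ∈ A.prodTrash ∧ M.δ s.1 σ = s'.1 then -β / (1 - γ)
  else if s ∈ A.prodAccept ∪ A.prodTrash then 0
  else -β

/-- Law of the successor of `s` in the product automaton under the policy `π`. -/
noncomputable def nextPMF (M : PLDMDP X Act O) (A : TotalDFA O S) (π : X × S → Act)
    (s : X × S) : PMF (X × S) :=
  PMF.ofFintype (fun s' => ENNReal.ofReal (M.prodProb A s (π s) s')) (by
    rw [← ENNReal.ofReal_sum_of_nonneg fun s' _ => M.prodProb_nonneg A s (π s) s',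
      M.prodProb_sum, ENNReal.ofReal_one])

/-- The finite state set `X × S` carries its discrete σ-algebra. -/
@[reducible] def stateMeasurableSpace (X S : Type*) : MeasurableSpace (X × S) := ⊤

attribute [local instance 2000] stateMeasurableSpace

/-- Transition kernel of the Markov chain on the product automaton under `π`. -/
noncomputable def chainKernel (M : PLDMDP X Act O) (A : TotalDFA O S) (π : X × S → Act) :
    Kernel (X × S) (X × S) where
  toFun s := (M.nextPMF A π s).toMeasure
  measurable' := measurable_from_top

instance (M : PLDMDP X Act O) (A : TotalDFA O S) (π : X × S → Act) :
    IsMarkovKernel (M.chainKernel A π) :=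
  ⟨fun s => inferInstanceAs (IsProbabilityMeasure (M.nextPMF A π s).toMeasure)⟩

/-- Law of the trajectory of the Markov chain on the product automaton under `π` from `s`. -/
noncomputable def trajLaw (M : PLDMDP X Act O) (A : TotalDFA O S) (π : X × S → Act)
    (s : X × S) : Measure (ℕ → X × S) :=
  Kernel.traj (X := fun _ => X × S)
    (fun n => (M.chainKernel A π).comap (fun p : (i : Finset.Iic n) → X × S =>
      p ⟨n, Finset.mem_Iic.2 le_rfl⟩) (measurable_pi_apply _))
    0 (fun _ => s)

/-- Expected discounted return from `s` under `π`. -/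
noncomputable def expectedReturn (M : PLDMDP X Act O) (A : TotalDFA O S) (β γ : ℝ)
    (π : X × S → Act) (s : X × S) : ℝ :=
  ∫ ω, ∑' i : ℕ, γ ^ i * M.reward A β γ (ω i) (π (ω i)) (ω (i + 1)) ∂(M.trajLaw A π s)

/-- `π` maximizes the expected return from all states simultaneously. -/
def IsOptimalPolicy (M : PLDMDP X Act O) (A : TotalDFA O S) (β γ : ℝ)
    (π : X × S → Act) : Prop :=
  ∀ (π' : X × S → Act) (s : X × S),
    M.expectedReturn A β γ π' s ≤ M.expectedReturn A β γ π s

/-- From every non-trash state, some trajectory that `π` generates with transitions of non-zero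
probability visits an accepting state. -/
def IsNonzeroProbSatisfying (M : PLDMDP X Act O) (A : TotalDFA O S) (π : X × S → Act) : Prop :=
  ∀ s : X × S, s ∉ A.prodTrash →
    ∃ ω : ℕ → X × S, ω 0 = s ∧ (∀ i, 0 < M.prodProb A (ω i) (π (ω i)) (ω (i + 1))) ∧
      ∃ i, ω i ∈ A.prodAccept

/-! ### Value iteration -/

/-- The value of action `σ` in state `s` with respect to the value function `v`. -/
noncomputable def qValue (M : PLDMDP X Act O) (A : TotalDFA O S) (β γ : ℝ)
    (v : X × S → ℝ) (s : X × S) (σ : Act) : ℝ :=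
  ∑ s' : X × S, M.prodProb A s σ s' * (M.reward A β γ s σ s' + γ * v s')

/-- One pass of the while loop of value iteration: the states are processed in the given order,
values are overwritten in place, and `ε` records the largest change. -/
noncomputable def sweep [Nonempty Act] (M : PLDMDP X Act O) (A : TotalDFA O S) (β γ : ℝ)
    (order : List (X × S)) (v : X × S → ℝ) : (X × S → ℝ) × ℝ :=
  order.foldl (fun p s =>
    let new := Finset.univ.sup' Finset.univ_nonempty (M.qValue A β γ p.1 s)
    (Function.update p.1 s new, max p.2 |new - p.1 s|)) (v, 0)

/-- The values after `k` passes, starting from `0`. -/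
noncomputable def viValue [Nonempty Act] (M : PLDMDP X Act O) (A : TotalDFA O S) (β γ : ℝ)
    (order : List (X × S)) : ℕ → X × S → ℝ
  | 0 => 0
  | k + 1 => (M.sweep A β γ order (M.viValue A β γ order k)).1

/-- The largest change in pass `k + 1`. -/
noncomputable def viChange [Nonempty Act] (M : PLDMDP X Act O) (A : TotalDFA O S) (β γ : ℝ)
    (order : List (X × S)) (k : ℕ) : ℝ :=
  (M.sweep A β γ order (M.viValue A β γ order k)).2

/-- The while loop of value iteration with threshold `ε₀` is left after exactly `k + 1` passes
(the first pass is always made, as `ε = ∞` before it). -/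
def ViStops [Nonempty Act] (M : PLDMDP X Act O) (A : TotalDFA O S) (β γ ε₀ : ℝ)
    (order : List (X × S)) (k : ℕ) : Prop :=
  M.viChange A β γ order k ≤ ε₀ ∧ ∀ j < k, ε₀ < M.viChange A β γ order j

/-- `π` is a policy that value iteration can return: its loop stops, and `π` takes in every state
an action that is greedy for the final values. -/
def ViReturns [Nonempty Act] (M : PLDMDP X Act O) (A : TotalDFA O S) (β γ ε₀ : ℝ)
    (order : List (X × S)) (π : X × S → Act) : Prop :=
  ∃ k, M.ViStops A β γ ε₀ order k ∧ ∀ s σ,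
    M.qValue A β γ (M.viValue A β γ order (k + 1)) s σ ≤
      M.qValue A β γ (M.viValue A β γ order (k + 1)) s (π s)

end PLDMDP

/-! ### Main algorithm -/

/-- The variables of the main algorithm at the head of its loop. -/
structure Config (X Act O S : Type*) where
  model : PLDMDP X Act O
  pos : X
  dfaState : S
  policy : X × S → Act
  time : ℕ
  actions : List Act
  uncertain : Set X

namespace Config

variable {X Act O S : Type*}

/-- The loop guard: the current product state is not accepting. -/
def Running (A : TotalDFA O S) (C : Config X Act O S) : Prop :=
  (C.pos, C.dfaState) ∉ A.prodAccept

/-- The states within the range `h` of the sensors. -/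
def sensorRange (h : ℕ) (C : Config X Act O S) : Set X := C.model.hopNbhd h C.pos

/-- The model with the most recent belief, which includes what is sensed at the current state. -/
noncomputable def sensed (h : ℕ) (C : Config X Act O S) : PLDMDP X Act O :=
  C.model.updateMap (C.sensorRange h)

/-- The replanning test; it compares the truth with the belief held before the current state was
entered. -/
def Replans [Fintype O] (h : ℕ) (C : Config X Act O S) : Prop :=
  0 < C.model.infoNorm (C.sensorRange h) ∨ C.time = 0

/-- The body of the main loop; `planned` is the policy that the planner returns if it is called. -/
noncomputable def body [Fintype O] (A : TotalDFA O S) (h : ℕ) (planned : X × S → Act)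
    (C : Config X Act O S) : Config X Act O S :=
  let π := if C.Replans h then planned else C.policy
  let a := π (C.pos, C.dfaState)
  let x' := C.model.δ C.pos a
  { model := C.sensed h
    pos := x'
    dfaState := A.step C.dfaState (C.model.ltrue x')
    policy := π
    time := C.time + 1
    actions := C.actions ++ [a]
    uncertain := C.uncertain \ C.model.hopNbhd h x' }

end Config

namespace PLDMDP

variable {X Act O S : Type*} [Fintype O]

/-- The configuration of the main algorithm after `n` loop passes (or after it has left the loop,
if this happens earlier), when `plan n` is the policy returned by the planner if it is called in
pass `n`. It starts in the state `x₀` and the automaton state `q₀`; the initial value of the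
variable `policy` is irrelevant, since the planner is called in the first pass. -/
noncomputable def mainLoop (M : PLDMDP X Act O) (A : TotalDFA O S) (h : ℕ) (x₀ : X) (q₀ : S)
    (plan : ℕ → X × S → Act) : ℕ → Config X Act O S
  | 0 =>
    { model := M
      pos := x₀
      dfaState := q₀
      policy := plan 0
      time := 0
      actions := []
      uncertain := (M.hopNbhd h x₀)ᶜ }
  | n + 1 =>
    let C := M.mainLoop A h x₀ q₀ plan n
    if C.Running A then C.body A h (plan n) else C

/-- Whenever the main algorithm calls its planner, the policy it uses is one that the planner can
return for the product of the automaton with the most recent model. -/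
def IsRun (M : PLDMDP X Act O) (A : TotalDFA O S) (h : ℕ) (x₀ : X) (q₀ : S)
    (planner : PLDMDP X Act O → (X × S → Act) → Prop) (plan : ℕ → X × S → Act) : Prop :=
  ∀ n, (M.mainLoop A h x₀ q₀ plan n).Running A → (M.mainLoop A h x₀ q₀ plan n).Replans h →
    planner ((M.mainLoop A h x₀ q₀ plan n).sensed h) (plan n)

/-- At any time during the mission there is a non-zero probability satisfying policy. -/
def AlwaysSatisfiable (M : PLDMDP X Act O) (A : TotalDFA O S) (h : ℕ) (x₀ : X) (q₀ : S)
    (plan : ℕ → X × S → Act) : Prop :=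
  ∀ n, (M.mainLoop A h x₀ q₀ plan n).Running A →
    ∃ π, ((M.mainLoop A h x₀ q₀ plan n).sensed h).IsNonzeroProbSatisfying A π

/-- The main algorithm leaves its loop, and the action sequence that it returns generates a good
prefix of `φ`: the word of the labels seen after the start if the automaton was started in its
initial state, and the word that includes the label of `x₀` if the automaton had read that label
before the start. -/
def Succeeds (M : PLDMDP X Act O) (A : TotalDFA O S) (φ : SCLTL O) (h : ℕ) (x₀ : X) (q₀ : S)
    (plan : ℕ → X × S → Act) : Prop :=
  ∃ T, ¬ (M.mainLoop A h x₀ q₀ plan T).Running A ∧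
    (q₀ = A.start →
      (M.word x₀ (M.mainLoop A h x₀ q₀ plan T).actions).tail ∈ φ.goodPrefixes) ∧
    (q₀ = A.step A.start (M.ltrue x₀) →
      M.word x₀ (M.mainLoop A h x₀ q₀ plan T).actions ∈ φ.goodPrefixes)

end PLDMDP

/-! Put `K = β / (1 - γ)` and let `W` be `U + K` outside the trash and `0` inside (`excess`). The
rewards are tuned so that `W` is `γ` times its average over the successors at every state that is
neither trash nor accepting (`Evaluates.excess_eq`), while `W = K` on reachable accepting states,
which are never left. So on reachable states `W` is `K` times the expectation of `γ ^ τ`, `τ` being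
the hitting time of acceptance, and it is positive exactly where acceptance has non-zero
probability. Under Assumption 2 an optimal policy has `W > 0` at all reachable non-trash states
(`IsProgressing`).

Since `1 ≤ h`, the label of the next state is known when an action is chosen, so the average
collapses to the true successor: `W` now equals `γ` times `W` next (`Evaluates.excess_step`).
Positivity then propagates and keeps the run out of the trash. Sensing only enlarges the finite set
of states with known label, so a run that never stops would eventually keep one policy and one `W`;
then `W = γ ^ k * W' ≤ γ ^ k * K` for all `k`, contradicting `W > 0` (`exists_not_running`).

For value iteration, only finitely many beliefs can arise, one for each set of sensed states. Hence
one positive gap separates optimal from suboptimal actions in all of them, and below a suitable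
threshold greedy policies use optimal actions only (`exists_threshold`). -/

/-! ### Discounted return of a Markov chain with finitely many states -/

namespace FiniteChain

variable {E : Type*} [MeasurableSpace E]

/-- Law of the trajectory from `s` of the Markov chain with transition kernel `κ`. -/
noncomputable def law (κ : Kernel E E) [IsMarkovKernel κ] (s : E) : Measure (ℕ → E) :=
  Kernel.traj (X := fun _ => E)
    (fun n => κ.comap (fun p : (i : Finset.Iic n) → E => p ⟨n, Finset.mem_Iic.2 le_rfl⟩)
      (measurable_pi_apply _)) 0 (fun _ => s)

instance (κ : Kernel E E) [IsMarkovKernel κ] (s : E) : IsProbabilityMeasure (law κ s) := by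
  unfold law; infer_instance

/-- Expected value of `f` after one transition. -/
noncomputable def avg (κ : Kernel E E) (f : E → ℝ) (x : E) : ℝ := ∫ y, f y ∂κ x

variable (κ : Kernel E E) [IsMarkovKernel κ]

theorem abs_iterate_avg_le (f : E → ℝ) (C : ℝ) (hC : ∀ x, |f x| ≤ C) (n : ℕ) (x : E) :
    |(avg κ)^[n] f x| ≤ C := by
  induction n generalizing f with
  | zero => simpa using hC x
  | succ n ih =>
    rw [Function.iterate_succ_apply]
    refine ih _ fun y => ?_
    have := norm_integral_le_of_norm_le_const (μ := κ y) (f := f) (C := C) (ae_of_all _ hC)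
    simpa [avg] using this

variable [DiscreteMeasurableSpace E]

theorem law_eval_zero (s : E) (f : E → ℝ) : ∫ ω, f (ω 0) ∂law κ s = f s := by
  rw [law, Kernel.integral_traj]
  · simp [Function.updateFinset]
  · have h3 : Measurable f := Measurable.of_discrete
    exact (h3.comp (measurable_pi_apply 0)).aestronglyMeasurable

variable [Fintype E]

theorem integrable_comp_pair (s : E) (n m : ℕ) (g : E → E → ℝ) :
    Integrable (fun ω : ℕ → E => g (ω n) (ω m)) (law κ s) := by
  obtain ⟨C, hC⟩ : ∃ C, ∀ p : E × E, ‖g p.1 p.2‖ ≤ C := by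
    obtain ⟨C, hC⟩ := (Set.finite_range fun p : E × E => ‖g p.1 p.2‖).bddAbove
    exact ⟨C, fun p => hC ⟨p, rfl⟩⟩
  refine Integrable.of_bound (C := C) ?_ (ae_of_all _ fun ω => hC (ω n, ω m))
  have h1 : Measurable fun p : E × E => g p.1 p.2 := Measurable.of_discrete
  have h2 : Measurable fun ω : ℕ → E => (ω n, ω m) := by fun_prop
  exact (h1.comp h2).aestronglyMeasurable

/-- The Markov property: the law of the path up to time `n` together with the next state is a
composition product, whose second kernel depends on the path only through its last state. -/
theorem integral_comp_pair (s : E) (n : ℕ) (g : E → E → ℝ) :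
    ∫ ω, g (ω n) (ω (n + 1)) ∂law κ s = ∫ ω, avg κ (g (ω n)) (ω n) ∂law κ s := by
  set K : (n : ℕ) → Kernel ((i : Finset.Iic n) → E) E := fun n =>
    κ.comap (fun p : (i : Finset.Iic n) → E => p ⟨n, Finset.mem_Iic.2 le_rfl⟩)
      (measurable_pi_apply _) with hK
  have h1 := Kernel.partialTraj_compProd_eq_map_traj (X := fun _ => E) (κ := K)
    (Nat.zero_le n) (x₀ := fun _ => s)
  have hg : Measurable fun p : E × E => g p.1 p.2 := Measurable.of_discrete
  have hm : Measurable fun p : ((i : Finset.Iic n) → E) × E =>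
      g (p.1 ⟨n, Finset.mem_Iic.2 le_rfl⟩) p.2 := by
    have h2 : Measurable fun p : ((i : Finset.Iic n) → E) × E =>
        (p.1 ⟨n, Finset.mem_Iic.2 le_rfl⟩, p.2) := by fun_prop
    exact hg.comp h2
  have hint : Integrable (fun p : ((i : Finset.Iic n) → E) × E =>
      g (p.1 ⟨n, Finset.mem_Iic.2 le_rfl⟩) p.2)
      ((Kernel.partialTraj (X := fun _ => E) K 0 n (fun _ => s)) ⊗ₘ (K n)) := by
    rw [h1, integrable_map_measure hm.aestronglyMeasurable (by fun_prop)]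
    exact integrable_comp_pair κ s n (n + 1) g
  have h2 := Measure.integral_compProd hint
  rw [h1, integral_map (by fun_prop) hm.aestronglyMeasurable,
    ← Kernel.traj_map_frestrictLe_apply, integral_map (by fun_prop)] at h2
  · exact h2
  · have h3 : Measurable fun x : E => avg κ (g x) x := Measurable.of_discrete
    exact (h3.comp (measurable_pi_apply (⟨n, Finset.mem_Iic.2 le_rfl⟩ : Finset.Iic n))).aestronglyMeasurable

theorem integral_comp_eval (s : E) (n : ℕ) (f : E → ℝ) :
    ∫ ω, f (ω n) ∂law κ s = (avg κ)^[n] f s := by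
  induction n generalizing f with
  | zero => simpa using law_eval_zero κ s f
  | succ n ih =>
    rw [integral_comp_pair κ s n (fun _ y => f y), Function.iterate_succ_apply, ← ih]

theorem avg_eq_sum (f : E → ℝ) (x : E) : avg κ f x = ∑ y, (κ x).real {y} * f y := by
  rw [avg, integral_fintype .of_finite]
  simp

/-- The expected discounted return satisfies the policy evaluation equation. -/
theorem discountedReturn_eq (γ : ℝ) (h0 : 0 ≤ γ) (h1 : γ < 1) (r : E → E → ℝ) (s : E) :
    ∫ ω, ∑' i : ℕ, γ ^ i * r (ω i) (ω (i + 1)) ∂law κ s =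
      ∑ y, (κ s).real {y} *
        (r s y + γ * ∫ ω, ∑' i : ℕ, γ ^ i * r (ω i) (ω (i + 1)) ∂law κ y) := by
  obtain ⟨C, hC⟩ : ∃ C, ∀ p : E × E, |r p.1 p.2| ≤ C := by
    obtain ⟨C, hC⟩ := (Set.finite_range fun p : E × E => |r p.1 p.2|).bddAbove
    exact ⟨C, fun p => hC ⟨p, rfl⟩⟩
  set f : E → ℝ := fun x => avg κ (r x) x with hf
  have hfC : ∀ x, |f x| ≤ C := fun x => by
    simpa [hf, avg] using norm_integral_le_of_norm_le_const (μ := κ x) (f := r x) (C := C)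
      (ae_of_all _ fun y => hC (x, y))
  have hsum : ∀ x, Summable fun i : ℕ => γ ^ i * (avg κ)^[i] f x := fun x => by
    refine Summable.of_norm_bounded (g := fun i : ℕ => γ ^ i * C)
      ((summable_geometric_of_lt_one h0 h1).mul_right C) fun i => ?_
    rw [norm_mul, norm_pow, Real.norm_eq_abs, abs_of_nonneg h0, Real.norm_eq_abs]
    gcongr
    exact abs_iterate_avg_le κ f C hfC i x
  -- Sum and expectation are exchanged under the geometric bound `γ ^ i * C`; the `i`-th expected
  -- reward is the one-step mean `f` averaged `i` times.
  have key : ∀ x, ∫ ω, ∑' i : ℕ, γ ^ i * r (ω i) (ω (i + 1)) ∂law κ x =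
      ∑' i : ℕ, γ ^ i * (avg κ)^[i] f x := fun x => by
    rw [← integral_tsum_of_summable_integral_norm]
    · refine tsum_congr fun i => ?_
      rw [integral_const_mul, integral_comp_pair, ← integral_comp_eval]
    · exact fun i => (integrable_comp_pair κ x i (i + 1) r).const_mul _
    · refine Summable.of_nonneg_of_le (fun i => integral_nonneg fun _ => norm_nonneg _)
        (fun i => ?_) ((summable_geometric_of_lt_one h0 h1).mul_right C)
      have := integral_mono (μ := law κ x)
        ((integrable_comp_pair κ x i (i + 1) r).const_mul (γ ^ i)).norm
        (integrable_const (γ ^ i * C)) (fun ω => by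
          simp only [norm_mul, norm_pow, Real.norm_eq_abs, abs_of_nonneg h0]
          exact mul_le_mul_of_nonneg_left (hC (ω i, ω (i + 1))) (pow_nonneg h0 i))
      simpa using this
  simp only [key]
  -- The term `i = 0` is the immediate reward; the remaining ones are `γ` times the average of the
  -- series at the successors.
  rw [(hsum s).tsum_eq_zero_add]
  simp only [mul_add, Finset.sum_add_distrib, pow_zero, one_mul, Function.iterate_zero, id]
  congr 1
  · simp only [hf, avg_eq_sum]
  · simp only [← tsum_mul_left]
    rw [← Summable.tsum_finsetSum fun y _ => ((hsum y).mul_left γ).mul_left _]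
    refine tsum_congr fun i => ?_
    rw [Function.iterate_succ_apply', avg_eq_sum, Finset.mul_sum]
    refine Finset.sum_congr rfl fun y _ => ?_
    ring

end FiniteChain

/-! ### Good prefixes and reachable automaton states -/

/-- Following `w ++ [l]` by `u` is the same as following `w` by `l` and then `u`. -/
theorem SCLTL.append_singleton_mem_goodPrefixes {O : Type*} {φ : SCLTL O} {w : List (Finset O)}
    (hw : w ∈ φ.goodPrefixes) (l : Finset O) : w ++ [l] ∈ φ.goodPrefixes := by
  intro u
  have h1 := hw (fun n => if n = 0 then l else u (n - 1))
  convert h1 using 1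
  funext n
  unfold SCLTL.prepend
  rcases lt_trichotomy n w.length with h | h | h
  · have : n < w.length + 1 := by omega
    simp [h, this, List.getElem_append_left]
  · subst h
    simp
  · have h2 : ¬ n < w.length + 1 := by omega
    have h3 : ¬ n < w.length := by omega
    have h4 : n - w.length ≠ 0 := by omega
    simp [h2, h3, h4, Nat.sub_sub]

namespace TotalDFA

variable {X O S : Type*}

/-- The states that the automaton can enter. -/
def reachable (A : TotalDFA O S) : Set S := Set.range A.eval

theorem step_mem_reachable (A : TotalDFA O S) {s : S} (hs : s ∈ A.reachable) (l : Finset O) :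
    A.step s l ∈ A.reachable := by
  obtain ⟨w, rfl⟩ := hs
  exact ⟨w ++ [l], by simp⟩

/-- Reachability matters: the accepted language says nothing about states that no word leads to. -/
theorem step_mem_accept (A : TotalDFA O S) {φ : SCLTL O} (hA : A.accepts = φ.goodPrefixes)
    {s : S} (hs : s ∈ A.reachable) (ha : s ∈ A.accept) (l : Finset O) :
    A.step s l ∈ A.accept := by
  obtain ⟨w, rfl⟩ := hs
  have h1 : w ∈ A.accepts := ha
  rw [hA] at h1
  have h2 := SCLTL.append_singleton_mem_goodPrefixes h1 l
  rw [← hA] at h2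
  simpa [DFA.mem_accepts] using h2

/-- The reachable accepting states are never left. -/
def AcceptClosed (A : TotalDFA O S) : Prop :=
  ∀ s ∈ A.reachable, s ∈ A.accept → ∀ l, A.step s l ∈ A.accept

theorem ne_trash_of_mem_accept (A : TotalDFA O S) {s : S} (hs : s ∈ A.accept) : s ≠ A.trash :=
  fun h => A.trash_not_accept (h ▸ hs)

end TotalDFA

/-! ### Closed sets of product states and the comparison principle -/

namespace PLDMDP

variable {X Act O S : Type*} [Fintype O]

theorem exists_step_of_prodProb_pos (M : PLDMDP X Act O) (A : TotalDFA O S) {s s' : X × S}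
    {σ : Act} (h : 0 < M.prodProb A s σ s') : M.δ s.1 σ = s'.1 ∧ ∃ l, A.step s.2 l = s'.2 := by
  unfold prodProb at h
  split_ifs at h with h1
  · exact ⟨h1.2, let ⟨l, _, _, hl⟩ := h1.1.2; ⟨l, hl⟩⟩
  · exact absurd h (lt_irrefl _)

/-- A set of product states that transitions of non-zero probability do not leave. -/
def Closed (M : PLDMDP X Act O) (A : TotalDFA O S) (D : Set (X × S)) : Prop :=
  ∀ s ∈ D, ∀ σ s', 0 < M.prodProb A s σ s' → s' ∈ D

theorem closed_of_step (M : PLDMDP X Act O) (A : TotalDFA O S) {R : Set S}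
    (hR : ∀ s ∈ R, ∀ l, A.step s l ∈ R) : M.Closed A {s | s.2 ∈ R} := by
  intro s hs σ s' hp
  obtain ⟨-, l, hl⟩ := M.exists_step_of_prodProb_pos A hp
  change s'.2 ∈ R
  rw [← hl]
  exact hR _ hs l

theorem closed_univ (M : PLDMDP X Act O) (A : TotalDFA O S) : M.Closed A Set.univ :=
  fun _ _ _ _ _ => trivial

theorem closed_trash (M : PLDMDP X Act O) (A : TotalDFA O S) :
    M.Closed A {s | s.2 = A.trash} :=
  M.closed_of_step A (R := {A.trash}) fun s hs l => by
    rw [Set.mem_singleton_iff] at hs ⊢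
    rw [hs, A.step_trash]

theorem closed_reachable (M : PLDMDP X Act O) (A : TotalDFA O S) :
    M.Closed A {s | s.2 ∈ A.reachable} :=
  M.closed_of_step A fun _ hs l => A.step_mem_reachable hs l

theorem closed_accept (M : PLDMDP X Act O) {A : TotalDFA O S} (hA : A.AcceptClosed) :
    M.Closed A {s | s.2 ∈ A.reachable ∩ A.accept} :=
  M.closed_of_step A fun s hs l => ⟨A.step_mem_reachable hs.1 l, hA s hs.1 hs.2 l⟩

variable [Fintype X] [Fintype S]

theorem sum_prodProb_congr (M : PLDMDP X Act O) (A : TotalDFA O S) {D : Set (X × S)}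
    (hD : M.Closed A D) {s : X × S} (hs : s ∈ D) (σ : Act) {f g : X × S → ℝ}
    (hfg : ∀ s' ∈ D, f s' = g s') :
    ∑ s', M.prodProb A s σ s' * f s' = ∑ s', M.prodProb A s σ s' * g s' := by
  refine Finset.sum_congr rfl fun s' _ => ?_
  rcases (M.prodProb_nonneg A s σ s').eq_or_lt with h | h
  · simp [← h]
  · rw [hfg s' (hD s hs σ s' h)]

theorem sum_prodProb_mono (M : PLDMDP X Act O) (A : TotalDFA O S) {D : Set (X × S)}
    (hD : M.Closed A D) {s : X × S} (hs : s ∈ D) (σ : Act) {f g : X × S → ℝ}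
    (hfg : ∀ s' ∈ D, f s' ≤ g s') :
    ∑ s', M.prodProb A s σ s' * f s' ≤ ∑ s', M.prodProb A s σ s' * g s' := by
  refine Finset.sum_le_sum fun s' _ => ?_
  rcases (M.prodProb_nonneg A s σ s').eq_or_lt with h | h
  · simp [← h]
  · exact mul_le_mul_of_nonneg_left (hfg s' (hD s hs σ s' h)) h.le

theorem sum_prodProb_const (M : PLDMDP X Act O) (A : TotalDFA O S) (s : X × S) (σ : Act)
    (c : ℝ) : ∑ s', M.prodProb A s σ s' * c = c := by
  rw [← Finset.sum_mul, M.prodProb_sum, one_mul]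

/-- Comparison principle for discounted subsolutions. -/
theorem nonpos_of_le_discounted (M : PLDMDP X Act O) (A : TotalDFA O S) {γ : ℝ} (h0 : 0 ≤ γ)
    (h1 : γ < 1) (π : X × S → Act) {D : Set (X × S)} (hD : M.Closed A D) {f : X × S → ℝ}
    (hf : ∀ s ∈ D, f s ≤ γ * ∑ s', M.prodProb A s (π s) s' * f s') : ∀ s ∈ D, f s ≤ 0 := by
  intro s hs
  -- At a maximizer `m` of `f` on `D` the average is at most `f m`, so `f m ≤ γ * f m`, which forces
  -- `f m ≤ 0`.
  obtain ⟨m, hm, hmax⟩ := D.toFinite.exists_maximalFor f D ⟨s, hs⟩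
  have hmax' : ∀ s' ∈ D, f s' ≤ f m := fun s' hs' => by
    by_contra! h
    exact absurd (hmax hs' h.le) (not_le.2 h)
  have h2 := M.sum_prodProb_mono A hD hm (π m) hmax'
  rw [M.sum_prodProb_const] at h2
  have h3 := (hf m hm).trans (mul_le_mul_of_nonneg_left h2 h0)
  have h4 : f m ≤ 0 := by nlinarith
  exact (hmax' s hs).trans h4

/-- The policy evaluation equation. -/
def Evaluates (M : PLDMDP X Act O) (A : TotalDFA O S) (β γ : ℝ) (π : X × S → Act)
    (U : X × S → ℝ) : Prop :=
  ∀ s, U s = M.qValue A β γ U s (π s)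

section expectedReturn

attribute [local instance 2000] stateMeasurableSpace

theorem chainKernel_real_singleton (M : PLDMDP X Act O) (A : TotalDFA O S) (π : X × S → Act)
    (s s' : X × S) : (M.chainKernel A π s).real {s'} = M.prodProb A s (π s) s' := by
  change ((M.nextPMF A π s).toMeasure {s'}).toReal = _
  rw [PMF.toMeasure_apply_singleton _ _ (MeasurableSet.of_discrete)]
  simp [nextPMF, M.prodProb_nonneg]

theorem evaluates_expectedReturn (M : PLDMDP X Act O) (A : TotalDFA O S) (β : ℝ) {γ : ℝ}
    (h0 : 0 ≤ γ) (h1 : γ < 1) (π : X × S → Act) :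
    M.Evaluates A β γ π (M.expectedReturn A β γ π) := by
  intro s
  have h := FiniteChain.discountedReturn_eq (M.chainKernel A π) γ h0 h1
    (fun x y => M.reward A β γ x (π x) y) s
  simp only [chainKernel_real_singleton] at h
  exact h

end expectedReturn

/-! ### Values of policies and their excess -/

section evaluation

variable {M : PLDMDP X Act O} {A : TotalDFA O S} {β γ : ℝ} {π : X × S → Act} {U : X × S → ℝ}

theorem qValue_eq_add (M : PLDMDP X Act O) (A : TotalDFA O S) (β γ : ℝ) (v : X × S → ℝ)
    (s : X × S) (σ : Act) : M.qValue A β γ v s σ =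
      ∑ s', M.prodProb A s σ s' * M.reward A β γ s σ s' +
        γ * ∑ s', M.prodProb A s σ s' * v s' := by
  rw [qValue, Finset.mul_sum, ← Finset.sum_add_distrib]
  exact Finset.sum_congr rfl fun s' _ => by ring

theorem qValue_sub_qValue (M : PLDMDP X Act O) (A : TotalDFA O S) (β γ : ℝ) (v w : X × S → ℝ)
    (s : X × S) (σ : Act) : M.qValue A β γ v s σ - M.qValue A β γ w s σ =
      γ * ∑ s', M.prodProb A s σ s' * (v s' - w s') := by
  simp only [qValue_eq_add, mul_sub, Finset.sum_sub_distrib]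
  ring

omit [Fintype X] [Fintype S] [Fintype O] in
theorem reward_nonpos (M : PLDMDP X Act O) (A : TotalDFA O S) (hβ : 0 < β) (h1 : γ < 1)
    (s : X × S) (σ : Act) (s' : X × S) : M.reward A β γ s σ s' ≤ 0 := by
  have : 0 < β / (1 - γ) := div_pos hβ (by linarith)
  unfold reward
  split_ifs
  · rw [neg_div]; linarith
  · exact le_rfl
  · linarith

theorem Evaluates.nonpos (hU : M.Evaluates A β γ π U) (hβ : 0 < β) (h0 : 0 ≤ γ) (h1 : γ < 1)
    (s : X × S) : U s ≤ 0 := by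
  refine M.nonpos_of_le_discounted A h0 h1 π (M.closed_univ A) (fun s _ => ?_) s trivial
  conv_lhs => rw [hU s, qValue_eq_add]
  have : ∑ s', M.prodProb A s (π s) s' * M.reward A β γ s (π s) s' ≤ 0 :=
    Finset.sum_nonpos fun s' _ => mul_nonpos_of_nonneg_of_nonpos (M.prodProb_nonneg _ _ _ _)
      (M.reward_nonpos A hβ h1 _ _ _)
  linarith

/-- Without rewards inside `D`, both `U` and `-U` are discounted subsolutions there. -/
theorem Evaluates.eq_zero_of_closed (hU : M.Evaluates A β γ π U) (h0 : 0 ≤ γ) (h1 : γ < 1)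
    {D : Set (X × S)} (hD : M.Closed A D)
    (hr : ∀ s ∈ D, ∀ s' ∈ D, M.reward A β γ s (π s) s' = 0) : ∀ s ∈ D, U s = 0 := by
  have h2 : ∀ s ∈ D, U s = γ * ∑ s', M.prodProb A s (π s) s' * U s' := fun s hs => by
    conv_lhs => rw [hU s, qValue_eq_add, M.sum_prodProb_congr A hD hs (π s) (hr s hs)]
    simp
  intro s hs
  refine le_antisymm (M.nonpos_of_le_discounted A h0 h1 π hD (fun s hs => (h2 s hs).le) s hs) ?_
  have h3 := M.nonpos_of_le_discounted A h0 h1 π hD (f := fun s => - U s) (fun s hs => by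
    simp only [mul_neg, Finset.sum_neg_distrib]
    exact (neg_inj.2 (h2 s hs)).le) s hs
  linarith

theorem Evaluates.eq_zero_of_trash (hU : M.Evaluates A β γ π U) (h0 : 0 ≤ γ) (h1 : γ < 1)
    {s : X × S} (hs : s.2 = A.trash) : U s = 0 :=
  hU.eq_zero_of_closed h0 h1 (M.closed_trash A) (fun s hs s' hs' => by
    have h2 : s ∈ A.prodTrash := hs
    simp [reward, h2]) s hs

theorem Evaluates.eq_zero_of_accept (hU : M.Evaluates A β γ π U) (hA : A.AcceptClosed)
    (h0 : 0 ≤ γ) (h1 : γ < 1) {s : X × S} (hs : s.2 ∈ A.reachable) (hs' : s.2 ∈ A.accept) :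
    U s = 0 :=
  hU.eq_zero_of_closed h0 h1 (M.closed_accept hA) (fun s hs s' hs' => by
    have h2 : s' ∉ A.prodTrash := A.ne_trash_of_mem_accept hs'.2
    have h3 : s ∈ A.prodAccept := hs.2
    simp [reward, h2, h3]) s ⟨hs, hs'⟩

/-- The return in excess of the one of never visiting an accepting state. -/
noncomputable def excess (A : TotalDFA O S) (β γ : ℝ) (U : X × S → ℝ) (s : X × S) : ℝ :=
  if s.2 = A.trash then 0 else U s + β / (1 - γ)

/-- With `K = β / (1 - γ)`, an ordinary step costs `β = K - γ * K`, so `U + K` becomes `γ * (U' +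
K)`; a step into the trash costs exactly `K` and leaves excess `0`. -/
theorem Evaluates.excess_eq (hU : M.Evaluates A β γ π U) (h0 : 0 ≤ γ) (h1 : γ < 1)
    {s : X × S} (hs : s.2 ≠ A.trash) (hs' : s.2 ∉ A.accept) :
    excess A β γ U s = γ * ∑ s', M.prodProb A s (π s) s' * excess A β γ U s' := by
  have h2 : ∀ s', M.prodProb A s (π s) s' * (M.reward A β γ s (π s) s' + γ * U s') =
      γ * (M.prodProb A s (π s) s' * excess A β γ U s') -
        M.prodProb A s (π s) s' * (β / (1 - γ)) := by
    intro s'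
    rcases (M.prodProb_nonneg A s (π s) s').eq_or_lt with h | h
    · simp [← h]
    have hd := (M.exists_step_of_prodProb_pos A h).1
    have h3 : (1 - γ) ≠ 0 := by linarith
    by_cases ht : s'.2 = A.trash
    · rw [hU.eq_zero_of_trash h0 h1 ht]
      simp [reward, TotalDFA.prodTrash, excess, hs, ht, hd, neg_div]
    · have : M.reward A β γ s (π s) s' = -β := by
        simp [reward, TotalDFA.prodTrash, TotalDFA.prodAccept, hs, ht, hs']
      rw [this, excess, if_neg ht]
      field_simp
      ring
  rw [excess, if_neg hs]
  conv_lhs => rw [hU s, qValue, Finset.sum_congr rfl fun s' _ => h2 s', Finset.sum_sub_distrib,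
    M.sum_prodProb_const, ← Finset.mul_sum]
  ring

omit [Fintype X] [Fintype S] [Fintype O] in
theorem excess_of_ne {s : X × S} (hs : s.2 ≠ A.trash) :
    excess A β γ U s = U s + β / (1 - γ) := if_neg hs

omit [Fintype X] [Fintype S] [Fintype O] in
theorem excess_of_eq {s : X × S} (hs : s.2 = A.trash) : excess A β γ U s = 0 := if_pos hs

theorem Evaluates.excess_of_accept (hU : M.Evaluates A β γ π U) (hA : A.AcceptClosed)
    (h0 : 0 ≤ γ) (h1 : γ < 1) {s : X × S} (hs : s.2 ∈ A.reachable) (hs' : s.2 ∈ A.accept) :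
    excess A β γ U s = β / (1 - γ) := by
  rw [excess_of_ne (A.ne_trash_of_mem_accept hs'), hU.eq_zero_of_accept hA h0 h1 hs hs', zero_add]

/-- The comparison principle applies to the negated excess on the reachable states: it is `0`
throughout the trash, a negative constant on acceptance, and solves the discounted equation
elsewhere. -/
theorem Evaluates.excess_nonneg (hU : M.Evaluates A β γ π U) (hA : A.AcceptClosed)
    (hβ : 0 < β) (h0 : 0 ≤ γ) (h1 : γ < 1) {s : X × S} (hs : s.2 ∈ A.reachable) :
    0 ≤ excess A β γ U s := by
  have h2 := M.nonpos_of_le_discounted A h0 h1 π (M.closed_reachable A)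
    (f := fun s => - excess A β γ U s) (fun s hs => by
      by_cases ht : s.2 = A.trash
      · rw [M.sum_prodProb_congr A (M.closed_trash A) ht (π s)
          (g := fun _ => 0) (fun s' hs' => by simp [excess_of_eq (A := A) hs'])]
        simp [excess_of_eq ht]
      by_cases ha : s.2 ∈ A.accept
      · rw [M.sum_prodProb_congr A (M.closed_accept hA) ⟨hs, ha⟩ (π s)
          (g := fun _ => -(β / (1 - γ))) (fun s' hs' => by
            rw [hU.excess_of_accept hA h0 h1 hs'.1 hs'.2]), M.sum_prodProb_const,
          hU.excess_of_accept hA h0 h1 hs ha]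
        have : 0 < β / (1 - γ) := div_pos hβ (by linarith)
        nlinarith
      · simp only [mul_neg, Finset.sum_neg_distrib]
        exact (neg_inj.2 (hU.excess_eq h0 h1 ht ha)).le) s hs
  linarith

/-- Positivity travels backwards along the path: the excess is `γ` times an average of nonnegative
terms, one of which, at `ω 1`, is positive by induction. -/
theorem Evaluates.excess_pos_of_path (hU : M.Evaluates A β γ π U) (hA : A.AcceptClosed)
    (hβ : 0 < β) (h0 : 0 < γ) (h1 : γ < 1) (n : ℕ) (ω : ℕ → X × S)
    (hω : ∀ i, 0 < M.prodProb A (ω i) (π (ω i)) (ω (i + 1))) (hs : (ω 0).2 ∈ A.reachable)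
    (hn : ω n ∈ A.prodAccept) : 0 < excess A β γ U (ω 0) := by
  have hpos : 0 < β / (1 - γ) := div_pos hβ (by linarith)
  induction n generalizing ω with
  | zero => rwa [hU.excess_of_accept hA h0.le h1 hs hn]
  | succ n ih =>
    have h2 : (ω 1).2 ∈ A.reachable := M.closed_reachable A _ hs _ _ (hω 0)
    have h3 := ih (fun i => ω (i + 1)) (fun i => hω (i + 1)) h2 hn
    by_cases ha : (ω 0).2 ∈ A.accept
    · rwa [hU.excess_of_accept hA h0.le h1 hs ha]
    -- The trash is absorbing, so starting there would make the excess at `ω 1` vanish.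
    have ht : (ω 0).2 ≠ A.trash := fun ht => by
      have : (ω 1).2 = A.trash := M.closed_trash A _ ht _ _ (hω 0)
      exact h3.ne' (excess_of_eq this)
    rw [hU.excess_eq h0.le h1 ht ha]
    refine mul_pos h0 (Finset.sum_pos' (fun s' _ => ?_) ⟨ω 1, Finset.mem_univ _, mul_pos (hω 0) h3⟩)
    rcases (M.prodProb_nonneg A (ω 0) (π (ω 0)) s').eq_or_lt with h | h
    · simp [← h]
    · exact mul_nonneg h.le
        (hU.excess_nonneg hA hβ h0.le h1 (M.closed_reachable A _ hs _ _ h))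

theorem IsNonzeroProbSatisfying.lt_of_evaluates (hπ : M.IsNonzeroProbSatisfying A π)
    (hU : M.Evaluates A β γ π U) (hA : A.AcceptClosed) (hβ : 0 < β) (h0 : 0 < γ) (h1 : γ < 1)
    {s : X × S} (hs : s.2 ∈ A.reachable) (ht : s.2 ≠ A.trash) : -(β / (1 - γ)) < U s := by
  obtain ⟨ω, rfl, hω, n, hn⟩ := hπ s ht
  have := hU.excess_pos_of_path hA hβ h0 h1 n ω hω hs hn
  rw [excess_of_ne ht] at this
  linarith

/-- The policy reaches an accepting state with non-zero probability from every reachable state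
outside the trash, as witnessed by its value function. -/
def IsProgressing (M : PLDMDP X Act O) (A : TotalDFA O S) (β γ : ℝ) (π : X × S → Act) : Prop :=
  ∃ U, M.Evaluates A β γ π U ∧
    ∀ s : X × S, s.2 ∈ A.reachable → s.2 ≠ A.trash → -(β / (1 - γ)) < U s

/-- The optimal return dominates that of the policy from Assumption 2, which already exceeds `-(β /
(1 - γ))`. -/
theorem IsOptimalPolicy.isProgressing (hπ : M.IsOptimalPolicy A β γ π) (hA : A.AcceptClosed)
    (hβ : 0 < β) (h0 : 0 < γ) (h1 : γ < 1) (hM : ∃ π', M.IsNonzeroProbSatisfying A π') :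
    M.IsProgressing A β γ π := by
  obtain ⟨π', hπ'⟩ := hM
  exact ⟨_, M.evaluates_expectedReturn A β h0.le h1 π, fun s hs ht =>
    (hπ'.lt_of_evaluates (M.evaluates_expectedReturn A β h0.le h1 π') hA hβ h0 h1 hs ht).trans_le
      (hπ π' s)⟩

end evaluation

end PLDMDP

/-! ### Value iteration -/

namespace PLDMDP

variable {X Act O S : Type*} [Fintype O] [Fintype X] [Fintype S]
variable {M : PLDMDP X Act O} {A : TotalDFA O S} {β γ : ℝ}

theorem abs_qValue_sub_le (h0 : 0 ≤ γ) {v w : X × S → ℝ} {d : ℝ} (hd : ∀ s, |v s - w s| ≤ d)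
    (s : X × S) (σ : Act) : |M.qValue A β γ v s σ - M.qValue A β γ w s σ| ≤ γ * d := by
  rw [qValue_sub_qValue, abs_mul, abs_of_nonneg h0]
  refine mul_le_mul_of_nonneg_left ((Finset.abs_sum_le_sum_abs _ _).trans ?_) h0
  rw [← M.sum_prodProb_const A s σ d]
  refine Finset.sum_le_sum fun s' _ => ?_
  rw [abs_mul, abs_of_nonneg (M.prodProb_nonneg A s σ s')]
  exact mul_le_mul_of_nonneg_left (hd s') (M.prodProb_nonneg A s σ s')

variable [Fintype Act] [Nonempty Act]

/-- The value of the best action with respect to the value function `v`. -/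
noncomputable def bestValue (M : PLDMDP X Act O) (A : TotalDFA O S) (β γ : ℝ)
    (v : X × S → ℝ) (s : X × S) : ℝ :=
  Finset.univ.sup' Finset.univ_nonempty (M.qValue A β γ v s)

theorem qValue_le_bestValue (M : PLDMDP X Act O) (A : TotalDFA O S) (β γ : ℝ)
    (v : X × S → ℝ) (s : X × S) (σ : Act) : M.qValue A β γ v s σ ≤ M.bestValue A β γ v s :=
  Finset.le_sup' (M.qValue A β γ v s) (Finset.mem_univ σ)

theorem bestValue_le_iff (v : X × S → ℝ) (s : X × S) (c : ℝ) :
    M.bestValue A β γ v s ≤ c ↔ ∀ σ, M.qValue A β γ v s σ ≤ c := by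
  simp [bestValue]

theorem abs_bestValue_sub_le (h0 : 0 ≤ γ) {v w : X × S → ℝ} {d : ℝ}
    (hd : ∀ s, |v s - w s| ≤ d) (s : X × S) :
    |M.bestValue A β γ v s - M.bestValue A β γ w s| ≤ γ * d := by
  have h := fun σ => abs_le.1 (abs_qValue_sub_le (M := M) (A := A) (β := β) h0 hd s σ)
  have h1 : M.bestValue A β γ v s ≤ M.bestValue A β γ w s + γ * d :=
    (bestValue_le_iff _ _ _).2 fun σ => by
      linarith [(h σ).2, M.qValue_le_bestValue A β γ w s σ]
  have h2 : M.bestValue A β γ w s ≤ M.bestValue A β γ v s + γ * d :=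
    (bestValue_le_iff _ _ _).2 fun σ => by
      linarith [(h σ).1, M.qValue_le_bestValue A β γ v s σ]
  exact abs_le.2 ⟨by linarith, by linarith⟩

/-- The Bellman optimality equation. -/
def IsBellman (M : PLDMDP X Act O) (A : TotalDFA O S) (β γ : ℝ) (V : X × S → ℝ) : Prop :=
  ∀ s, M.bestValue A β γ V s = V s

theorem exists_isBellman (M : PLDMDP X Act O) (A : TotalDFA O S) (β : ℝ) (h0 : 0 ≤ γ)
    (h1 : γ < 1) : ∃ V, M.IsBellman A β γ V := by
  have hc : ContractingWith ⟨γ, h0⟩ (M.bestValue A β γ) := by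
    refine ⟨h1, LipschitzWith.of_dist_le_mul fun v w => ?_⟩
    refine (dist_pi_le_iff (by positivity)).2 fun s => ?_
    exact abs_bestValue_sub_le h0 (fun s => dist_le_pi_dist v w s) s
  exact ⟨_, fun s => congrFun hc.fixedPoint_isFixedPt s⟩

/-- The update of one state during a pass of value iteration. -/
noncomputable def relax (M : PLDMDP X Act O) (A : TotalDFA O S) (β γ : ℝ)
    (p : (X × S → ℝ) × ℝ) (s : X × S) : (X × S → ℝ) × ℝ :=
  (Function.update p.1 s (M.bestValue A β γ p.1 s), max p.2 |M.bestValue A β γ p.1 s - p.1 s|)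

/-- In-place updates still contract: every update reads values with error at most `d` and writes one
with error at most `γ * d`. The list holds the states yet to be processed; all others already
satisfy the better bound. -/
theorem abs_foldl_relax_sub_le (h0 : 0 ≤ γ) {V : X × S → ℝ} (hV : M.IsBellman A β γ V) {d : ℝ}
    (hγd : γ * d ≤ d) (order : List (X × S)) (p : (X × S → ℝ) × ℝ)
    (hp : ∀ s, |p.1 s - V s| ≤ d) (hp' : ∀ s ∉ order, |p.1 s - V s| ≤ γ * d) (s : X × S) :
    |(order.foldl (M.relax A β γ) p).1 s - V s| ≤ γ * d := by
  induction order generalizing p with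
  | nil => simpa using hp' s
  | cons t l ih =>
    have ht : |M.bestValue A β γ p.1 t - V t| ≤ γ * d := by
      rw [← hV t]; exact abs_bestValue_sub_le h0 hp t
    rw [List.foldl_cons]
    refine ih _ (fun s => ?_) fun s hs => ?_
    · by_cases h : s = t
      · subst h; simpa [relax] using ht.trans hγd
      · simpa [relax, h] using hp s
    · by_cases h : s = t
      · subst h; simpa [relax] using ht
      · simpa [relax, h] using hp' s (by simp [h, hs])

/-- The old and the new value of a state both lie within `d` of `V`. -/
theorem foldl_relax_snd_le (h0 : 0 ≤ γ) {V : X × S → ℝ} (hV : M.IsBellman A β γ V) {d : ℝ}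
    (hγd : γ * d ≤ d) (order : List (X × S)) (p : (X × S → ℝ) × ℝ)
    (hp : ∀ s, |p.1 s - V s| ≤ d) (hp' : p.2 ≤ 2 * d) :
    (order.foldl (M.relax A β γ) p).2 ≤ 2 * d := by
  induction order generalizing p with
  | nil => simpa using hp'
  | cons t l ih =>
    have ht : |M.bestValue A β γ p.1 t - V t| ≤ d := by
      rw [← hV t]; exact (abs_bestValue_sub_le h0 hp t).trans hγd
    rw [List.foldl_cons]
    refine ih _ (fun s => ?_) ?_
    · by_cases h : s = t
      · subst h; simpa [relax] using ht
      · simpa [relax, h] using hp s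
    · refine max_le hp' ?_
      have h1 := abs_le.1 ht
      have h2 := abs_le.1 (hp t)
      exact abs_le.2 ⟨by linarith, by linarith⟩

/-- As no state occurs twice, each is overwritten at most once, and its net change over the pass is
a recorded one. -/
theorem abs_sub_le_foldl_relax_snd (order : List (X × S)) (ho : order.Nodup)
    (p : (X × S → ℝ) × ℝ) :
    p.2 ≤ (order.foldl (M.relax A β γ) p).2 ∧
      (∀ s ∉ order, (order.foldl (M.relax A β γ) p).1 s = p.1 s) ∧
      ∀ s ∈ order, |(order.foldl (M.relax A β γ) p).1 s - p.1 s| ≤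
        (order.foldl (M.relax A β γ) p).2 := by
  induction order generalizing p with
  | nil => simp
  | cons t l ih =>
    obtain ⟨htl, hl⟩ := List.nodup_cons.1 ho
    obtain ⟨h1, h2, h3⟩ := ih hl (M.relax A β γ p t)
    simp only [List.foldl_cons]
    refine ⟨(le_max_left _ _).trans h1, fun s hs => ?_, fun s hs => ?_⟩
    · rw [List.mem_cons, not_or] at hs
      rw [h2 s hs.2]
      simp [relax, hs.1]
    · by_cases h : s = t
      · subst h
        rw [h2 s htl]
        refine le_trans ?_ h1
        simp [relax]
      · have h4 := h3 s ((List.mem_cons.1 hs).resolve_left h)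
        simpa [relax, h] using h4

theorem abs_viValue_sub_le (h0 : 0 ≤ γ) (h1 : γ < 1) {V : X × S → ℝ}
    (hV : M.IsBellman A β γ V) {order : List (X × S)} (ho : ∀ s, s ∈ order) {d : ℝ} (hd0 : 0 ≤ d)
    {k : ℕ} (hd : ∀ s, |M.viValue A β γ order k s - V s| ≤ d) (s : X × S) :
    |M.viValue A β γ order (k + 1) s - V s| ≤ γ * d :=
  abs_foldl_relax_sub_le h0 hV (by nlinarith) order (M.viValue A β γ order k, 0) hd
    (fun s hs => absurd (ho s) hs) s

/-- The distance to the Bellman solution decays like `γ ^ k`, and the change in a pass is at most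
twice that distance. -/
theorem exists_viReturns (M : PLDMDP X Act O) (A : TotalDFA O S) (β : ℝ) (h0 : 0 ≤ γ)
    (h1 : γ < 1) {ε : ℝ} (hε : 0 < ε) {order : List (X × S)} (ho : ∀ s, s ∈ order) :
    ∃ π, M.ViReturns A β γ ε order π := by
  obtain ⟨V, hV⟩ := M.exists_isBellman A β h0 h1
  have hd : ∀ k s, |M.viValue A β γ order k s - V s| ≤ γ ^ k * dist 0 V := by
    intro k
    induction k with
    | zero => intro s; simpa [viValue] using dist_le_pi_dist 0 V s
    | succ k ih =>
      intro s
      rw [pow_succ', mul_assoc]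
      exact abs_viValue_sub_le h0 h1 hV ho (by positivity) ih s
  have hchange : ∀ k, M.viChange A β γ order k ≤ 2 * (γ ^ k * dist 0 V) := fun k => by
    have : 0 ≤ γ ^ k * dist 0 V := by positivity
    exact foldl_relax_snd_le h0 hV (by nlinarith) order (M.viValue A β γ order k, 0) (hd k)
      (by simpa using this)
  have hex : ∃ k, M.viChange A β γ order k ≤ ε := by
    have h2 : Filter.Tendsto (fun k : ℕ => 2 * (γ ^ k * dist 0 V)) Filter.atTop (nhds 0) := by
      simpa using ((tendsto_pow_atTop_nhds_zero_of_lt_one h0 h1).mul_const (dist 0 V)).const_mul 2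
    obtain ⟨k, hk⟩ := (h2.eventually (gt_mem_nhds hε)).exists
    exact ⟨k, (hchange k).trans hk.le⟩
  have hgreedy : ∀ s, ∃ σ, ∀ σ', M.qValue A β γ (M.viValue A β γ order (Nat.find hex + 1)) s σ' ≤
      M.qValue A β γ (M.viValue A β γ order (Nat.find hex + 1)) s σ :=
    fun s => Finite.exists_max _
  choose π hπ using hgreedy
  exact ⟨π, Nat.find hex, ⟨Nat.find_spec hex, fun j hj => not_le.1 (Nat.find_min hex hj)⟩, hπ⟩

/-- A last change of at most `ε` and the contraction together bound the error of the final values by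
`ε / (1 - γ)`. This error enters twice: for the best action and for the chosen one. -/
theorem ViReturns.near_optimal {ε : ℝ} {order : List (X × S)} {π : X × S → Act}
    (hπ : M.ViReturns A β γ ε order π) (h0 : 0 ≤ γ) (h1 : γ < 1) (hn : order.Nodup)
    (ho : ∀ s, s ∈ order) {V : X × S → ℝ} (hV : M.IsBellman A β γ V) (s : X × S) :
    V s - M.qValue A β γ V s (π s) ≤ 2 * (ε / (1 - γ)) := by
  obtain ⟨k, ⟨hk, -⟩, hg⟩ := hπ
  set v := M.viValue A β γ order k
  set v' := M.viValue A β γ order (k + 1)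
  have h2 : ∀ s, |v' s - V s| ≤ γ * dist v V := fun s =>
    abs_viValue_sub_le h0 h1 hV ho dist_nonneg (fun s => dist_le_pi_dist v V s) s
  have h3 : ∀ s, |v' s - v s| ≤ ε := fun s =>
    ((abs_sub_le_foldl_relax_snd order hn (v, 0)).2.2 s (ho s)).trans hk
  have hε : 0 ≤ ε := (abs_nonneg _).trans (h3 s)
  have h4 : dist v V ≤ ε + γ * dist v V :=
    (dist_pi_le_iff (add_nonneg hε (mul_nonneg h0 dist_nonneg))).2 fun s => by
      have a := abs_le.1 (h2 s)
      have b := abs_le.1 (h3 s)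
      exact abs_le.2 ⟨by linarith, by linarith⟩
  have h5 : dist v V ≤ ε / (1 - γ) := by
    rw [le_div_iff₀ (by linarith)]; linarith
  have h6 : ∀ s, |v' s - V s| ≤ ε / (1 - γ) := fun s => by
    have : γ * dist v V ≤ dist v V := by nlinarith [dist_nonneg (x := v) (y := V)]
    exact (h2 s).trans (this.trans h5)
  have h7 := fun σ => abs_le.1 (abs_qValue_sub_le (M := M) (A := A) (β := β) h0 h6 s σ)
  have h8 : γ * (ε / (1 - γ)) ≤ ε / (1 - γ) := by
    have : 0 ≤ ε / (1 - γ) := div_nonneg hε (by linarith)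
    nlinarith
  have h9 : V s ≤ M.qValue A β γ V s (π s) + 2 * (ε / (1 - γ)) := by
    rw [← hV s]
    refine (bestValue_le_iff _ _ _).2 fun σ => ?_
    linarith [(h7 σ).1, (h7 (π s)).2, hg s σ]
  linarith

omit [Fintype O] [Fintype X] [Fintype S] [Fintype Act] [Nonempty Act] in
theorem exists_pos_forall_lt_of_pos {ι : Type*} [Finite ι] (f : ι → ℝ) :
    ∃ δ > 0, ∀ i, 0 < f i → δ < f i := by
  have h : ∀ᶠ δ in nhdsWithin (0 : ℝ) (Set.Ioi 0), ∀ i, 0 < f i → δ < f i := by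
    refine Filter.eventually_all.2 fun i => ?_
    by_cases hi : 0 < f i
    · filter_upwards [nhdsWithin_le_nhds (gt_mem_nhds hi)] with δ hδ _ using hδ
    · exact Filter.Eventually.of_forall fun δ h => absurd h hi
  obtain ⟨δ, hδ, hδ0⟩ := (h.and self_mem_nhdsWithin).exists
  exact ⟨δ, hδ0, hδ⟩

/-- For finitely many models, value iteration with a small threshold returns policies that are
greedy for the optimal values. -/
theorem exists_threshold {ι : Type*} [Finite ι] (N : ι → PLDMDP X Act O) (A : TotalDFA O S)
    (β : ℝ) (h0 : 0 ≤ γ) (h1 : γ < 1) :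
    ∃ εmax > 0, ∀ ε, ε ≤ εmax → ∀ i order π, order.Nodup → (∀ s, s ∈ order) →
      (N i).ViReturns A β γ ε order π →
      ∃ V, (N i).IsBellman A β γ V ∧ (N i).Evaluates A β γ π V := by
  choose V hV using fun i => (N i).exists_isBellman A β h0 h1
  -- `δ` lies below every positive loss of an action, over all models, states and actions.
  obtain ⟨δ, hδ, hgap⟩ := exists_pos_forall_lt_of_pos
    fun i : ι × (X × S) × Act => V i.1 i.2.1 - (N i.1).qValue A β γ (V i.1) i.2.1 i.2.2
  -- The threshold makes the loss bound `2 * (ε / (1 - γ))` at most `δ`, so a greedy action loses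
  -- nothing.
  refine ⟨δ * (1 - γ) / 2, by have : 0 < 1 - γ := by linarith
                              positivity, fun ε hε i order π hn ho hπ => ⟨V i, hV i, fun s => ?_⟩⟩
  have h2 := hπ.near_optimal h0 h1 hn ho (hV i) s
  have h3 : 2 * (ε / (1 - γ)) ≤ δ := by
    rw [← mul_div_assoc, div_le_iff₀ (by linarith)]; linarith
  have h4 : (N i).qValue A β γ (V i) s (π s) ≤ V i s :=
    ((N i).qValue_le_bestValue A β γ _ s _).trans (hV i s).le
  by_contra h
  have := hgap (i, s, π s) (sub_pos.2 (lt_of_le_of_ne h4 (Ne.symm h)))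
  exact absurd (this.trans_le (h2.trans h3)) (lt_irrefl _)

/-- The Bellman solution dominates its one-step value under `π`, so `U - V` is a discounted
subsolution. -/
theorem IsBellman.le_of_evaluates {V U : X × S → ℝ} {π : X × S → Act}
    (hV : M.IsBellman A β γ V) (hU : M.Evaluates A β γ π U) (h0 : 0 ≤ γ) (h1 : γ < 1)
    (s : X × S) : U s ≤ V s := by
  have := M.nonpos_of_le_discounted A h0 h1 π (M.closed_univ A) (f := fun s => U s - V s)
    (fun s _ => by
      rw [← qValue_sub_qValue M A β γ U V s (π s), ← hU s]
      linarith [M.qValue_le_bestValue A β γ V s (π s), hV s]) s trivial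
  linarith

theorem IsBellman.isProgressing {V : X × S → ℝ} {π : X × S → Act} (hV : M.IsBellman A β γ V)
    (hπ : M.Evaluates A β γ π V) (hA : A.AcceptClosed) (hβ : 0 < β) (h0 : 0 < γ) (h1 : γ < 1)
    (hM : ∃ π', M.IsNonzeroProbSatisfying A π') : M.IsProgressing A β γ π := by
  obtain ⟨π', hπ'⟩ := hM
  have hU := M.evaluates_expectedReturn A β h0.le h1 π'
  exact ⟨V, hπ, fun s hs ht => (hπ'.lt_of_evaluates hU hA hβ h0 h1 hs ht).trans_le
    (hV.le_of_evaluates hU h0.le h1 s)⟩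

end PLDMDP

/-! ### The main algorithm -/

namespace PLDMDP

variable {X Act O S : Type*}

/-- The belief about the label of `y` is the point mass at the true label. -/
def KnowsLabel (M : PLDMDP X Act O) (y : X) : Prop :=
  ∀ l, M.pL y l = if l = M.ltrue y then 1 else 0

theorem updateMap_pL_of_mem (M : PLDMDP X Act O) {N : Set X} {y : X} (hy : y ∈ N)
    (l : Finset O) : (M.updateMap N).pL y l = if l = M.ltrue y then 1 else 0 := by
  by_cases hl : l = M.ltrue y <;> simp [updateMap, hy, hl]

theorem updateMap_pL_of_notMem (M : PLDMDP X Act O) {N : Set X} {y : X} (hy : y ∉ N)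
    (l : Finset O) : (M.updateMap N).pL y l = M.pL y l := by
  simp [updateMap, hy]

theorem updateMap_eq_self {M : PLDMDP X Act O} {N : Set X} (hN : ∀ y ∈ N, M.KnowsLabel y) :
    M.updateMap N = M := by
  have h : (M.updateMap N).pL = M.pL := by
    funext y l
    by_cases hy : y ∈ N
    · rw [updateMap_pL_of_mem M hy, hN y hy l]
    · exact updateMap_pL_of_notMem M hy l
  cases M
  simp only [updateMap] at h ⊢
  simp [h]

theorem updateMap_updateMap (M : PLDMDP X Act O) (N N' : Set X) :
    (M.updateMap N).updateMap N' = M.updateMap (N ∪ N') := by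
  have h : ((M.updateMap N).updateMap N').pL = (M.updateMap (N ∪ N')).pL := by
    funext y l
    by_cases hy' : y ∈ N'
    · rw [updateMap_pL_of_mem _ hy', updateMap_pL_of_mem _ (Set.mem_union_right N hy')]
      rfl
    · rw [updateMap_pL_of_notMem _ hy']
      by_cases hy : y ∈ N
      · rw [updateMap_pL_of_mem _ hy, updateMap_pL_of_mem _ (Set.mem_union_left N' hy)]
      · rw [updateMap_pL_of_notMem _ hy, updateMap_pL_of_notMem _ (by simp [hy, hy'])]
  simp only [updateMap] at h ⊢
  simp [h]

theorem updateMap_empty (M : PLDMDP X Act O) : M.updateMap ∅ = M :=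
  updateMap_eq_self fun _ hy => hy.elim

theorem knowsLabel_updateMap (M : PLDMDP X Act O) {N : Set X} {y : X}
    (hy : y ∈ N ∨ M.KnowsLabel y) : (M.updateMap N).KnowsLabel y := by
  intro l
  by_cases h : y ∈ N
  · exact updateMap_pL_of_mem M h l
  · exact (updateMap_pL_of_notMem M h l).trans (hy.resolve_left h l)

/-- Finiteness of `X` makes the supremum a genuine upper bound of the row sums. -/
theorem knowsLabel_of_infoNorm_le [Finite X] [Fintype O] {M : PLDMDP X Act O} {N : Set X}
    (h : M.infoNorm N ≤ 0) {y : X} (hy : y ∈ N) : M.KnowsLabel y := by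
  have h1 : ∑ l : Finset O, |M.infoMatrix N ⟨y, hy⟩ l| ≤ 0 :=
    (le_ciSup (f := fun x : N => ∑ l : Finset O, |M.infoMatrix N x l|)
      (Set.finite_range _).bddAbove ⟨y, hy⟩).trans h
  intro l
  have h2 : |M.infoMatrix N ⟨y, hy⟩ l| ≤ 0 :=
    (Finset.single_le_sum (fun l _ => abs_nonneg (M.infoMatrix N ⟨y, hy⟩ l))
      (Finset.mem_univ l)).trans h1
  have h3 := abs_eq_zero.1 (le_antisymm h2 (abs_nonneg _))
  by_cases hl : l = M.ltrue y
  · rw [infoMatrix, if_pos hl.symm, abs_eq_zero] at h3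
    rw [if_pos hl]
    linarith
  · rw [infoMatrix, if_neg (Ne.symm hl), abs_eq_zero] at h3
    rw [if_neg hl]
    linarith

theorem step_mem_hopNbhd (M : PLDMDP X Act O) {h : ℕ} (hh : 1 ≤ h) (x : X) (a : Act) :
    M.δ x a ∈ M.hopNbhd h x := ⟨[a], hh, rfl⟩

theorem prodProb_of_knowsLabel [Fintype O] {M : PLDMDP X Act O} (A : TotalDFA O S) {s : X × S}
    {a : Act} (hk : M.KnowsLabel (M.δ s.1 a)) (s' : X × S) :
    M.prodProb A s a s' =
      if s' = (M.δ s.1 a, A.step s.2 (M.ltrue (M.δ s.1 a))) then 1 else 0 := by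
  rw [prodProb_eq]
  obtain ⟨x', q'⟩ := s'
  by_cases hx : M.δ s.1 a = x'
  · subst hx
    rw [if_pos rfl]
    simp only [hk _, Prod.mk.injEq, true_and]
    rw [Finset.sum_ite_eq']
    simp [eq_comm]
  · simp [hx, Ne.symm hx]

/-- A known label at the next position makes the transition deterministic, so the average has a
single term: the product state that is really entered. -/
theorem Evaluates.excess_step [Fintype O] [Fintype X] [Fintype S] {M : PLDMDP X Act O}
    {A : TotalDFA O S} {β γ : ℝ} {π : X × S → Act} {U : X × S → ℝ}
    (hU : M.Evaluates A β γ π U) (h0 : 0 ≤ γ) (h1 : γ < 1) {s : X × S}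
    (hs : s.2 ≠ A.trash) (hs' : s.2 ∉ A.accept) (hk : M.KnowsLabel (M.δ s.1 (π s))) :
    excess A β γ U s =
      γ * excess A β γ U (M.δ s.1 (π s), A.step s.2 (M.ltrue (M.δ s.1 (π s)))) := by
  rw [hU.excess_eq h0 h1 hs hs']
  simp [prodProb_of_knowsLabel A hk]

theorem word_ne_nil (M : PLDMDP X Act O) (x : X) (l : List Act) : M.word x l ≠ [] := by
  cases l <;> simp [word, trajectory]

theorem word_concat (M : PLDMDP X Act O) (x : X) (l : List Act) (a : Act) :
    M.word x (l ++ [a]) = M.word x l ++ [M.ltrue (M.δ (l.foldl M.δ x) a)] := by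
  induction l generalizing x with
  | nil => simp [word, trajectory]
  | cons b l ih =>
    have := ih (M.δ x b)
    simp only [word, trajectory] at this ⊢
    simp [this]

theorem head_cons_tail_word (M : PLDMDP X Act O) (x : X) (l : List Act) :
    M.word x l = M.ltrue x :: (M.word x l).tail := by
  cases l <;> simp [word, trajectory]

/-! ### Invariants of a run -/

variable [Fintype O] (M : PLDMDP X Act O) (A : TotalDFA O S) (h : ℕ) (x₀ : X) (q₀ : S)
  (plan : ℕ → X × S → Act)

theorem mainLoop_succ {n : ℕ} (hn : (M.mainLoop A h x₀ q₀ plan n).Running A) :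
    M.mainLoop A h x₀ q₀ plan (n + 1) = (M.mainLoop A h x₀ q₀ plan n).body A h (plan n) := by
  simp [mainLoop, hn]

theorem mainLoop_succ_of_not {n : ℕ} (hn : ¬ (M.mainLoop A h x₀ q₀ plan n).Running A) :
    M.mainLoop A h x₀ q₀ plan (n + 1) = M.mainLoop A h x₀ q₀ plan n := by
  simp [mainLoop, hn]

/-- This confines the beliefs of all runs to a finite family indexed by `Set X`, as a uniform
threshold requires. -/
theorem exists_model_eq_updateMap (n : ℕ) :
    ∃ N, (M.mainLoop A h x₀ q₀ plan n).model = M.updateMap N := by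
  induction n with
  | zero => exact ⟨∅, M.updateMap_empty.symm⟩
  | succ n ih =>
    by_cases hn : (M.mainLoop A h x₀ q₀ plan n).Running A
    · obtain ⟨N, hN⟩ := ih
      rw [mainLoop_succ _ _ _ _ _ _ hn]
      exact ⟨N ∪ (M.mainLoop A h x₀ q₀ plan n).sensorRange h, by
        rw [← updateMap_updateMap, ← hN]; rfl⟩
    · rwa [mainLoop_succ_of_not _ _ _ _ _ _ hn]

theorem exists_sensed_eq_updateMap (n : ℕ) :
    ∃ N, (M.mainLoop A h x₀ q₀ plan n).sensed h = M.updateMap N := by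
  obtain ⟨N, hN⟩ := M.exists_model_eq_updateMap A h x₀ q₀ plan n
  exact ⟨N ∪ (M.mainLoop A h x₀ q₀ plan n).sensorRange h, by
    rw [← updateMap_updateMap, ← hN]; rfl⟩

/-- The tail appears because whether the label of `x₀` has been read is already encoded in `q₀`. -/
theorem mainLoop_consistent (n : ℕ) :
    (M.mainLoop A h x₀ q₀ plan n).pos = (M.mainLoop A h x₀ q₀ plan n).actions.foldl M.δ x₀ ∧
    (M.mainLoop A h x₀ q₀ plan n).dfaState =
      A.evalFrom q₀ (M.word x₀ (M.mainLoop A h x₀ q₀ plan n).actions).tail := by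
  induction n with
  | zero => simp [mainLoop, word, trajectory]
  | succ n ih =>
    by_cases hn : (M.mainLoop A h x₀ q₀ plan n).Running A
    · obtain ⟨N, hN⟩ := M.exists_model_eq_updateMap A h x₀ q₀ plan n
      have hδ : (M.mainLoop A h x₀ q₀ plan n).model.δ = M.δ := by rw [hN]; rfl
      have hl : (M.mainLoop A h x₀ q₀ plan n).model.ltrue = M.ltrue := by rw [hN]; rfl
      rw [mainLoop_succ _ _ _ _ _ _ hn]
      simp only [Config.body, hδ, hl]
      refine ⟨by simp [ih.1], ?_⟩
      rw [word_concat, List.tail_append_of_ne_nil (word_ne_nil _ _ _),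
        DFA.evalFrom_append_singleton, ← ih.1, ← ih.2]
    · rwa [mainLoop_succ_of_not _ _ _ _ _ _ hn]

variable {M A h x₀ q₀ plan}

theorem succeeds_of_not_running {φ : SCLTL O} (hA : A.accepts = φ.goodPrefixes) {T : ℕ}
    (hT : ¬ (M.mainLoop A h x₀ q₀ plan T).Running A) : M.Succeeds A φ h x₀ q₀ plan := by
  have hacc : (M.mainLoop A h x₀ q₀ plan T).dfaState ∈ A.accept := not_not.1 hT
  rw [(M.mainLoop_consistent A h x₀ q₀ plan T).2] at hacc
  refine ⟨T, hT, fun hq => ?_, fun hq => ?_⟩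
  · rw [← hA, DFA.mem_accepts, DFA.eval, ← hq]
    exact hacc
  · rw [← hA, DFA.mem_accepts, DFA.eval, head_cons_tail_word, DFA.evalFrom_cons, ← hq]
    exact hacc

/-! ### Termination of the main loop -/

section termination

variable [Fintype X]

theorem sensed_eq_of_not_replans {C : Config X Act O S} (hC : ¬ C.Replans h) :
    C.sensed h = C.model :=
  updateMap_eq_self fun _ hy =>
    knowsLabel_of_infoNorm_le (not_lt.1 fun h1 => hC (Or.inl h1)) hy

/-- If the loop is never left, the planner is called only finitely often. -/
theorem exists_forall_not_replans (hrun : ∀ n, (M.mainLoop A h x₀ q₀ plan n).Running A) :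
    ∃ n₀, ∀ n, n₀ ≤ n → 0 < n → ¬ (M.mainLoop A h x₀ q₀ plan n).Replans h := by
  have hsucc := fun n => M.mainLoop_succ A h x₀ q₀ plan (hrun n)
  have htime : ∀ n, (M.mainLoop A h x₀ q₀ plan n).time = n := fun n => by
    induction n with
    | zero => rfl
    | succ n ih => rw [hsucc, Config.body, ih]
  have hmono : Monotone fun n => {y | (M.mainLoop A h x₀ q₀ plan n).model.KnowsLabel y} :=
    monotone_nat_of_le_succ fun n y hy => by
      simp only [hsucc, Set.mem_ofPred_eq]
      exact knowsLabel_updateMap _ (Or.inr hy)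
  -- The increasing sets of states with known label stabilize, `X` being finite.
  obtain ⟨n₀, hn₀⟩ := WellFoundedGT.monotone_chain_condition ⟨_, hmono⟩
  refine ⟨n₀, fun n hn hpos hrep => ?_⟩
  have h1 : 0 < (M.mainLoop A h x₀ q₀ plan n).model.infoNorm
      ((M.mainLoop A h x₀ q₀ plan n).sensorRange h) :=
    hrep.resolve_right fun h2 => by rw [htime] at h2; omega
  -- What is sensed in pass `n` is known in pass `n + 1`, hence by stability was known before; the
  -- information norm is then zero.
  have h2 : ∀ y ∈ (M.mainLoop A h x₀ q₀ plan n).sensorRange h,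
      (M.mainLoop A h x₀ q₀ plan n).model.KnowsLabel y := fun y hy => by
    have h3 : y ∈ {y | (M.mainLoop A h x₀ q₀ plan (n + 1)).model.KnowsLabel y} := by
      simp only [hsucc, Set.mem_ofPred_eq]
      exact knowsLabel_updateMap _ (Or.inl hy)
    have h4 := (hn₀ n hn).symm.trans (hn₀ (n + 1) (by omega))
    change {y | (M.mainLoop A h x₀ q₀ plan n).model.KnowsLabel y} =
      {y | (M.mainLoop A h x₀ q₀ plan (n + 1)).model.KnowsLabel y} at h4
    exact (Set.ext_iff.1 h4 y).2 h3
  refine h1.not_ge (Real.iSup_nonpos fun y => Finset.sum_nonpos fun l _ => ?_)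
  by_cases hl : l = (M.mainLoop A h x₀ q₀ plan n).model.ltrue y
  · simp [infoMatrix, hl, h2 y y.2 _]
  · simp [infoMatrix, hl, Ne.symm hl, h2 y y.2 l]

/-- An endless run would multiply a positive bounded excess by `1 / γ` at each step once its policy
is frozen. -/
theorem exists_not_running [Fintype S] {β γ : ℝ} (hβ : 0 < β) (h0 : 0 < γ) (h1 : γ < 1) (hh : 1 ≤ h)
    (hq : q₀ ∈ A.reachable) (hq' : q₀ ≠ A.trash)
    (hplan : ∀ n, (M.mainLoop A h x₀ q₀ plan n).Running A →
      (M.mainLoop A h x₀ q₀ plan n).Replans h →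
      ((M.mainLoop A h x₀ q₀ plan n).sensed h).IsProgressing A β γ (plan n)) :
    ∃ T, ¬ (M.mainLoop A h x₀ q₀ plan T).Running A := by
  by_contra! hrun
  obtain ⟨n₀, hn₀⟩ := exists_forall_not_replans hrun
  set C := M.mainLoop A h x₀ q₀ plan
  have hsucc : ∀ n, C (n + 1) = (C n).body A h (plan n) :=
    fun n => M.mainLoop_succ A h x₀ q₀ plan (hrun n)
  -- Configuration `n + 1` stores the belief and the policy used in pass `n`. Without replanning the
  -- belief is unchanged, so the old policy stays progressing.
  have hprog : ∀ n, (C (n + 1)).model.IsProgressing A β γ (C (n + 1)).policy := by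
    intro n
    induction n with
    | zero =>
      have hrep : (C 0).Replans h := Or.inr rfl
      rw [hsucc]
      simpa [Config.body, hrep] using hplan 0 (hrun 0) hrep
    | succ n ih =>
      by_cases hrep : (C (n + 1)).Replans h
      · rw [hsucc]
        simpa [Config.body, hrep] using hplan (n + 1) (hrun _) hrep
      · rw [hsucc (n + 1)]
        simpa [Config.body, hrep, sensed_eq_of_not_replans hrep] using ih
  have hstep : ∀ n U, (C n).dfaState ≠ A.trash →
      (C (n + 1)).model.Evaluates A β γ (C (n + 1)).policy U →
      excess A β γ U ((C n).pos, (C n).dfaState) =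
        γ * excess A β γ U ((C (n + 1)).pos, (C (n + 1)).dfaState) := by
    intro n U ht hU
    rw [hsucc] at hU ⊢
    exact hU.excess_step h0.le h1 (s := ((C n).pos, (C n).dfaState)) ht (hrun n)
      (knowsLabel_updateMap _ (Or.inl (step_mem_hopNbhd _ hh _ _)))
  have hreach : ∀ n, (C n).dfaState ∈ A.reachable := by
    intro n
    induction n with
    | zero => exact hq
    | succ n ih => rw [hsucc]; exact A.step_mem_reachable ih _
  -- Entering the trash would give a positive excess equal to `γ * 0`.
  have htrash : ∀ n, (C n).dfaState ≠ A.trash := by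
    intro n
    induction n with
    | zero => exact hq'
    | succ n ih =>
      intro ht
      obtain ⟨U, hU, hpos⟩ := hprog n
      have h2 := hpos ((C n).pos, (C n).dfaState) (hreach n) ih
      have h3 := hstep n U ih hU
      rw [excess_of_ne ih, excess_of_eq (s := ((C (n + 1)).pos, (C (n + 1)).dfaState)) ht] at h3
      linarith
  -- The shift by one makes all passes considered positive, where replanning is excluded, and lets
  -- `hprog` apply to the frozen policy.
  have hconst : ∀ k, (C (n₀ + 1 + k)).model = (C (n₀ + 1)).model ∧
      (C (n₀ + 1 + k)).policy = (C (n₀ + 1)).policy := by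
    intro k
    induction k with
    | zero => exact ⟨rfl, rfl⟩
    | succ k ih =>
      have hrep := hn₀ (n₀ + 1 + k) (by omega) (by omega)
      rw [← add_assoc, hsucc, ← ih.1, ← ih.2]
      exact ⟨sensed_eq_of_not_replans hrep, if_neg hrep⟩
  obtain ⟨U, hU, hpos⟩ := hprog n₀
  have hiter : ∀ k, excess A β γ U ((C (n₀ + 1)).pos, (C (n₀ + 1)).dfaState) ≤
      γ ^ k * (β / (1 - γ)) := by
    intro k
    have h2 : excess A β γ U ((C (n₀ + 1)).pos, (C (n₀ + 1)).dfaState) =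
        γ ^ k * excess A β γ U ((C (n₀ + 1 + k)).pos, (C (n₀ + 1 + k)).dfaState) := by
      induction k with
      | zero => simp
      | succ k ih =>
        rw [ih, pow_succ, mul_assoc, ← add_assoc, ← hstep (n₀ + 1 + k) U (htrash _)]
        rw [add_assoc, (hconst (k + 1)).1, (hconst (k + 1)).2]
        exact hU
    -- Returns are nonpositive, so the excess never exceeds `β / (1 - γ)`.
    rw [h2, excess_of_ne (htrash _)]
    have h3 := hU.nonpos hβ h0.le h1 ((C (n₀ + 1 + k)).pos, (C (n₀ + 1 + k)).dfaState)
    exact mul_le_mul_of_nonneg_left (by linarith) (pow_nonneg h0.le k)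
  have hlim : Filter.Tendsto (fun k : ℕ => γ ^ k * (β / (1 - γ))) Filter.atTop (nhds 0) := by
    simpa using (tendsto_pow_atTop_nhds_zero_of_lt_one h0.le h1).mul_const (β / (1 - γ))
  have h2 := ge_of_tendsto' hlim hiter
  have h3 := hpos ((C (n₀ + 1)).pos, (C (n₀ + 1)).dfaState) (hreach _) (htrash _)
  rw [excess_of_ne (htrash _)] at h2
  linarith

end termination

end PLDMDP

theorem theorem1 {X Act O S : Type*} [Fintype X] [Fintype Act] [Nonempty Act] [Fintype O]
    [Fintype S] (M : PLDMDP X Act O) (β γ : ℝ) (hc : ∀ x y, M.c x y = β)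
    (hγ0 : 0 < γ) (hγ1 : γ < 1)
    (φ : SCLTL O) (A : TotalDFA O S) (hA : A.accepts = φ.goodPrefixes)
    (h : ℕ) (hh : 1 ≤ h) (x₀ : X) (q₀ : S)
    (hq₀ : q₀ = A.start ∨ q₀ = A.step A.start (M.ltrue x₀)) (hq₀' : q₀ ≠ A.trash) :
    -- replanning by any policies that maximize the expected return
    (∀ plan : ℕ → X × S → Act,
      M.IsRun A h x₀ q₀ (fun M' π => M'.IsOptimalPolicy A β γ π) plan →
      M.AlwaysSatisfiable A h x₀ q₀ plan → M.Succeeds A φ h x₀ q₀ plan) ∧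
    -- value iteration terminates
    (∀ ε₀ : ℝ, 0 < ε₀ → ∀ order : List (X × S), order.Nodup → (∀ s, s ∈ order) →
      ∀ M' : PLDMDP X Act O, ∃ π, M'.ViReturns A β γ ε₀ order π) ∧
    -- replanning by value iteration with a small enough convergence threshold
    ∃ εmax : ℝ, 0 < εmax ∧ ∀ ε₀ : ℝ, 0 < ε₀ → ε₀ ≤ εmax → ∀ plan : ℕ → X × S → Act,
      M.IsRun A h x₀ q₀ (fun M' π => ∃ order : List (X × S), order.Nodup ∧ (∀ s, s ∈ order) ∧
        M'.ViReturns A β γ ε₀ order π) plan →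
      M.AlwaysSatisfiable A h x₀ q₀ plan → M.Succeeds A φ h x₀ q₀ plan := by
  have hβ : 0 < β := hc x₀ x₀ ▸ M.c_pos x₀ x₀
  have hA' : A.AcceptClosed := fun s hs ha l => A.step_mem_accept hA hs ha l
  have hq : q₀ ∈ A.reachable := by
    rcases hq₀ with rfl | rfl
    · exact ⟨[], rfl⟩
    · exact ⟨[M.ltrue x₀], rfl⟩
  refine ⟨fun plan hrun hsat => ?_, fun ε₀ hε order _ ho M' =>
    M'.exists_viReturns A β hγ0.le hγ1 hε ho, ?_⟩
  · obtain ⟨T, hT⟩ := PLDMDP.exists_not_running hβ hγ0 hγ1 hh hq hq₀' fun n hn hrep =>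
      (hrun n hn hrep).isProgressing hA' hβ hγ0 hγ1 (hsat n hn)
    exact PLDMDP.succeeds_of_not_running hA hT
  -- Indexing by all sets of sensed states fixes the threshold before any run, order or tie-breaking
  -- is chosen.
  · obtain ⟨εmax, hpos, hε⟩ :=
      PLDMDP.exists_threshold (fun N : Set X => M.updateMap N) A β hγ0.le hγ1
    refine ⟨εmax, hpos, fun ε₀ _ hle plan hrun hsat => ?_⟩
    obtain ⟨T, hT⟩ := PLDMDP.exists_not_running hβ hγ0 hγ1 hh hq hq₀' fun n hn hrep => by
      obtain ⟨order, hnd, ho, hret⟩ := hrun n hn hrep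
      obtain ⟨N, hN⟩ := M.exists_sensed_eq_updateMap A h x₀ q₀ plan n
      have hM := hsat n hn
      rw [hN] at hret hM ⊢
      obtain ⟨V, hV, hev⟩ := hε ε₀ hle N order (plan n) hnd ho hret
      exact hV.isProgressing hev hA' hβ hγ0 hγ1 hM
    exact PLDMDP.succeeds_of_not_running hA hT
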